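/- Let $G$ be a countable directed graph (loops and multiple edges allowed) with range and source maps $r,s$, and let $\mathbb{F}^+(G)$ be its free semigroupoid: all vertices, regarded as paths of length $0$, and all finite paths $w=e_k\cdots e_1$ with $s(e_i)=r(e_{i-1})$. On the Hilbert space $\mathcal{H}_G=\ell^2(\mathbb{F}^+(G))$ with orthonormal basis $\{\xi_w\}$ let $L_e$, for an edge $e$, be the operator with $L_e\xi_w=\xi_{ew}$ if $s(e)=r(w)$ and $L_e\xi_w=0$ otherwise, and let $P_x$, for a vertex $x$, be the projection with $P_x\xi_w=\xi_w$ if $r(w)=x$ and $P_x\xi_w=0$ otherwise. Let $\mathfrak{L}_G$ be the closure in the weak operator topology of the norm closed algebra generated by all $L_e$ and $P_x$. Let $x$ be a vertex of $G$ and suppose that there are exactly $n$ distinct loop edges with source (and range) $x$, where $0\le n<\infty$. Let $\mathfrak{M}^{w^*}_{G,x}$ be the set of all multiplicative linear functionals $\rho:\mathfrak{L}_G\to\mathbb{C}$ with $\rho(P_x)=1$ that are continuous for the relative $w^*$-topology that $\mathfrak{L}_G$ inherits from $B(\mathcal{H}_G)$, the dual of the trace class operators. Then $\mathfrak{M}^{w^*}_{G,x}$,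 with the relative $w^*$-topology of the dual space of $\mathfrak{L}_G$ (pointwise convergence on $\mathfrak{L}_G$), is homeomorphic to the open unit ball $\{\lambda\in\mathbb{C}^n:\sum_{i=1}^n|\lambda_i|^2<1\}$ of $\mathbb{C}^n$. -/

import Mathlib

noncomputable section

namespace FreeSemigroupoid

universe u v

/-! ### The path space of a directed graph

A directed graph (multiple edges and loops allowed) with vertex set `V` is a quiver on `V`; the
edges with source `a` and range `b` are the elements of `a ⟶ b`. A path of length `k` from `a` to
`b` is an element of `Quiver.Path a b`; the path of length `0` at a vertex `a` is `Path.nil`, and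
`p.cons e` is the path which first follows `p` and then the edge `e`, i.e. the product `e p`. -/

/-- The paths with range `b`, each recorded together with its source. -/
abbrev PathsInto {V : Type u} [Quiver.{v} V] (b : V) : Type (max u v) :=
  Σ a : V, Quiver.Path a b

/-- The free semigroupoid of a directed graph: all vertices (as paths of length `0`) and all
paths of positive length. A path is recorded as (range, source, path). -/
abbrev PathSpace (V : Type u) [Quiver.{v} V] : Type (max u v) :=
  Σ b : V, PathsInto b

/-- The product `e w` of an edge `e : b ⟶ c` and a path `w` with range `b`. -/
def edgeMul {V : Type u} [Quiver.{v} V] {b c : V} (e : b ⟶ c) (w : PathsInto b) :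
    PathSpace V :=
  ⟨c, w.1, w.2.cons e⟩

theorem edgeMul_injective {V : Type u} [Quiver.{v} V] {b c : V} (e : b ⟶ c) :
    Function.Injective (edgeMul e) := by
  rintro ⟨a, p⟩ ⟨a', p'⟩ h
  simp only [edgeMul, Sigma.mk.injEq, heq_eq_eq, true_and] at h
  obtain ⟨rfl, h⟩ := h
  simp only [heq_eq_eq, Quiver.Path.cons.injEq, true_and, and_true] at h
  rw [h]

/-! ### Operators on the Fock space -/

/-- The Hilbert space `ℓ²(ι)`. -/
abbrev L2 (ι : Type*) : Type _ := lp (fun _ : ι => ℂ) 2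

open Classical in
/-- The standard basis vector `ξ_i` of `ℓ²(ι)`. -/
def basisVec {ι : Type*} (i : ι) : L2 ι := lp.single 2 i 1

theorem orthonormal_basisVec {ι κ : Type*} (c : ι → κ) (hc : Function.Injective c) :
    Orthonormal ℂ (fun i => basisVec (c i)) := by
  classical
  rw [orthonormal_iff_ite]
  intro i j
  simp [basisVec, lp.inner_single_left, lp.single_apply, Pi.single_apply, hc.eq_iff]

/-- The isometry `ℓ²(ι) → ℓ²(κ)`, `ξ_i ↦ ξ_{c i}`, given by an injective map `c`. -/
def pushforward {ι κ : Type*} (c : ι → κ) (hc : Function.Injective c) : L2 ι →L[ℂ] L2 κ :=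
  (orthonormal_basisVec c hc).orthogonalFamily.linearIsometry.toContinuousLinearMap

theorem pushforward_basisVec {ι κ : Type*} (c : ι → κ) (hc : Function.Injective c) (i : ι) :
    pushforward c hc (basisVec i) = basisVec (c i) := by
  classical
  have := (orthonormal_basisVec c hc).orthogonalFamily.linearIsometry_apply_single (i := i) (1 : ℂ)
  rw [LinearIsometry.toSpanSingleton_apply, one_smul] at this
  rw [← this]
  simp only [pushforward, basisVec, LinearIsometry.coe_toContinuousLinearMap]

/-- The Fock space `ℓ²(𝔽⁺(G))` of a directed graph. -/
abbrev Fock (V : Type u) [Quiver.{v} V] : Type (max u v) := L2 (PathSpace V)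

/-- The basis vector `ξ_w` of the Fock space. -/
abbrev xi {V : Type u} [Quiver.{v} V] {b : V} (w : PathsInto b) : Fock V :=
  basisVec (⟨b, w⟩ : PathSpace V)

/-- The adjoint of the isometry that includes `ℓ²` of the paths with range `b` into the Fock
space: `ξ_w ↦ ξ_w` if `r(w) = b`, and `ξ_w ↦ 0` otherwise. -/
def restrict {V : Type u} [Quiver.{v} V] (b : V) : Fock V →L[ℂ] L2 (PathsInto b) :=
  ContinuousLinearMap.adjoint
    (pushforward (Sigma.mk b : PathsInto b → PathSpace V) sigma_mk_injective)

/-- The left creation operator `L_e`: `L_e ξ_w = ξ_{e w}` if `s(e) = r(w)`, and `0` otherwise. -/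
def creation {V : Type u} [Quiver.{v} V] {b c : V} (e : b ⟶ c) : Fock V →L[ℂ] Fock V :=
  pushforward (edgeMul e) (edgeMul_injective e) ∘L restrict b

/-- The projection `P_x`: `P_x ξ_w = ξ_w` if `r(w) = x`, and `0` otherwise. -/
def vertexProj {V : Type u} [Quiver.{v} V] (x : V) : Fock V →L[ℂ] Fock V :=
  pushforward (Sigma.mk x : PathsInto x → PathSpace V) sigma_mk_injective ∘L restrict x

theorem restrict_xi_self {V : Type u} [Quiver.{v} V] {b : V} (w : PathsInto b) :
    restrict b (xi w) = basisVec w := by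
  have h : xi w = pushforward (Sigma.mk b : PathsInto b → PathSpace V) sigma_mk_injective
      (basisVec w) := (pushforward_basisVec _ _ _).symm
  refine ext_inner_left ℂ fun f => ?_
  rw [restrict, ContinuousLinearMap.adjoint_inner_right, h]
  exact LinearIsometry.inner_map_map _ _ _

theorem restrict_xi_of_ne {V : Type u} [Quiver.{v} V] {b b' : V} (h : b' ≠ b)
    (w : PathsInto b') : restrict b (xi w) = 0 := by
  classical
  refine ext_inner_left ℂ fun f => ?_
  rw [restrict, ContinuousLinearMap.adjoint_inner_right, inner_zero_right]
  have hs : HasSum (fun i : PathsInto b => f i • (basisVec (⟨b, i⟩ : PathSpace V) : Fock V))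
      (pushforward (Sigma.mk b : PathsInto b → PathSpace V) sigma_mk_injective f) :=
    (orthonormal_basisVec (Sigma.mk b : PathsInto b → PathSpace V)
      sigma_mk_injective).orthogonalFamily.hasSum_linearIsometry f
  have h0 : ∀ i : PathsInto b,
      inner ℂ (xi w) (f i • (basisVec (⟨b, i⟩ : PathSpace V) : Fock V)) = 0 := by
    intro i
    have hne : (⟨b', w⟩ : PathSpace V) ≠ ⟨b, i⟩ := fun e => h (congrArg Sigma.fst e)
    rw [inner_smul_right]
    simp [xi, basisVec, lp.inner_single_left, lp.single_apply, hne]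
  have h1 := hs.mapL (innerSL ℂ (xi w))
  simp only [innerSL_apply_apply, h0] at h1
  rw [← inner_conj_symm, h1.unique hasSum_zero, map_zero]

theorem creation_xi {V : Type u} [Quiver.{v} V] {b c : V} (e : b ⟶ c) (w : PathsInto b) :
    creation e (xi w) = xi (⟨w.1, w.2.cons e⟩ : PathsInto c) := by
  simp only [creation, ContinuousLinearMap.comp_apply, restrict_xi_self, pushforward_basisVec]
  rfl

theorem creation_xi_of_ne {V : Type u} [Quiver.{v} V] {b c b' : V} (e : b ⟶ c) (h : b' ≠ b)
    (w : PathsInto b') : creation e (xi w) = 0 := by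
  simp [creation, restrict_xi_of_ne h]

theorem vertexProj_xi {V : Type u} [Quiver.{v} V] {x : V} (w : PathsInto x) :
    vertexProj x (xi w) = xi w := by
  simp only [vertexProj, ContinuousLinearMap.comp_apply, restrict_xi_self, pushforward_basisVec]

theorem vertexProj_xi_of_ne {V : Type u} [Quiver.{v} V] {x b : V} (h : b ≠ x)
    (w : PathsInto b) : vertexProj x (xi w) = 0 := by
  simp [vertexProj, restrict_xi_of_ne h]

/-! ### The algebras -/

/-- The generators `L_e` and `P_x`. -/
def generators (V : Type u) [Quiver.{v} V] : Set (Fock V →L[ℂ] Fock V) :=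
  {T | (∃ (b c : V) (e : b ⟶ c), T = creation e) ∨ ∃ x : V, T = vertexProj x}

/-- The tensor algebra `𝒯₊(G)`: the norm closed (not necessarily unital) algebra generated by the
operators `L_e` and `P_x`. -/
def tensorAlgebra (V : Type u) [Quiver.{v} V] : NonUnitalSubalgebra ℂ (Fock V →L[ℂ] Fock V) :=
  (NonUnitalAlgebra.adjoin ℂ (generators V)).topologicalClosure

/-- The free semigroupoid algebra `𝔏_G`: the closure of the tensor algebra in the weak operator
topology. -/
def freeSemigroupoidAlgebra (V : Type u) [Quiver.{v} V] :
    NonUnitalSubalgebra ℂ (Fock V →L[ℂ] Fock V) :=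
  (((tensorAlgebra V).map
      (ContinuousLinearMapWOT.algEquiv (𝕜₁ := ℂ) (E := Fock V) ℂ).symm).topologicalClosure).map
    (ContinuousLinearMapWOT.algEquiv (𝕜₁ := ℂ) (E := Fock V) ℂ)

theorem mem_freeSemigroupoidAlgebra_iff {V : Type u} [Quiver.{v} V] (A : Fock V →L[ℂ] Fock V) :
    A ∈ freeSemigroupoidAlgebra V ↔
      ContinuousLinearMapWOT.ofCLM A ∈
        closure (ContinuousLinearMapWOT.ofCLM '' (tensorAlgebra V : Set (Fock V →L[ℂ] Fock V))) := by
  constructor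
  · rintro ⟨B, hB, rfl⟩
    exact hB
  · exact fun h => ⟨ContinuousLinearMapWOT.ofCLM A, h, rfl⟩

theorem vertexProj_mem {V : Type u} [Quiver.{v} V] (x : V) :
    vertexProj x ∈ freeSemigroupoidAlgebra V := by
  refine ⟨ContinuousLinearMapWOT.ofCLM (vertexProj x), ?_, rfl⟩
  refine NonUnitalSubalgebra.le_topologicalClosure _ ⟨vertexProj x, ?_, rfl⟩
  exact NonUnitalSubalgebra.le_topologicalClosure _
    (NonUnitalAlgebra.subset_adjoin ℂ (Or.inr ⟨x, rfl⟩))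

/-! ### The weak-star topology and the characters -/

/-- The `w*`-topology of `B(H)` (the dual of the trace class operators), also called the ultraweak
topology: the coarsest topology for which all the functionals `A ↦ ∑ₖ ⟨A xₖ, yₖ⟩` with
`∑ₖ ‖xₖ‖² < ∞` and `∑ₖ ‖yₖ‖² < ∞` are continuous. -/
@[reducible] def weakStarTopology (H : Type*) [NormedAddCommGroup H] [InnerProductSpace ℂ H] :
    TopologicalSpace (H →L[ℂ] H) :=
  ⨅ (x : lp (fun _ : ℕ => H) 2) (y : lp (fun _ : ℕ => H) 2),
    TopologicalSpace.induced (fun A : H →L[ℂ] H => ∑' k, inner ℂ (y k) (A (x k))) inferInstance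

/-- The series in the definition of the `w*`-topology converge absolutely. -/
theorem summable_weakStar {H : Type*} [NormedAddCommGroup H] [InnerProductSpace ℂ H]
    (A : H →L[ℂ] H) (x y : lp (fun _ : ℕ => H) 2) :
    Summable fun k => ‖inner ℂ (y k) (A (x k))‖ := by
  have hx : Summable fun k => ‖x k‖ ^ 2 := by simpa using (lp.memℓp x).summable (by norm_num)
  have hy : Summable fun k => ‖y k‖ ^ 2 := by simpa using (lp.memℓp y).summable (by norm_num)
  refine Summable.of_nonneg_of_le (fun _ => norm_nonneg _) (fun k => ?_)
    ((hy.add hx).mul_left ‖A‖)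
  have h1 : ‖inner ℂ (y k) (A (x k))‖ ≤ ‖y k‖ * (‖A‖ * ‖x k‖) :=
    (norm_inner_le_norm _ _).trans (by gcongr; exact A.le_opNorm _)
  nlinarith [norm_nonneg A, sq_nonneg (‖y k‖ - ‖x k‖), sq_nonneg ‖x k‖, sq_nonneg ‖y k‖,
    mul_nonneg (norm_nonneg A) (sq_nonneg (‖y k‖ - ‖x k‖)),
    mul_nonneg (norm_nonneg A) (add_nonneg (sq_nonneg ‖x k‖) (sq_nonneg ‖y k‖))]

/-- Continuity of a scalar function on `𝔏_G` for the relative `w*`-topology of `B(H)`. -/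
def IsWeakStarContinuous {V : Type u} [Quiver.{v} V] (φ : freeSemigroupoidAlgebra V → ℂ) : Prop :=
  @Continuous _ _ ((weakStarTopology (Fock V)).induced Subtype.val) inferInstance φ

/-- The `w*`-continuous characters `ρ` of `𝔏_G` with `ρ(P_x) = 1`, as a subset of the space of all
(norm continuous, nonzero) characters of `𝔏_G`; the latter carries the `w*`-topology of the dual of
`𝔏_G`, i.e. the topology of pointwise convergence on `𝔏_G`. -/
def weakStarCharacters {V : Type u} [Quiver.{v} V] (x : V) :
    Set (WeakDual.characterSpace ℂ (freeSemigroupoidAlgebra V)) :=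
  {ρ | IsWeakStarContinuous (fun A => ρ A) ∧ ρ ⟨vertexProj x, vertexProj_mem x⟩ = 1}

end FreeSemigroupoid

end

namespace FreeSemigroupoid

open Filter Topology
open scoped ComplexConjugate

universe u v

/-! ### Standard basis vectors -/

section Basis

variable {ι : Type*}

/-! The homeomorphism sends `ρ` to its loop values `z = (ρ(L_{e_i}))_i`, where `e_1, …, e_n` are the
loops at `x`. Write `R_z = ∑ conj(z_i) L_{e_i}`. Distinct edges have creation operators with
orthogonal ranges, so `R_z^* R_z = ‖z‖² P_x` and `‖R_z‖ ≤ ‖z‖`.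

Every point of the ball occurs: `ν_z = (1 - R_z)⁻¹ ξ_x` is a joint eigenvector of the adjoints of
the generators, hence of the adjoint of every element of `𝔏_G` (`inner_eigenvector_apply`). So `A ↦
⟨A ξ_x, ν_z⟩` is multiplicative, and its loop values are `z`.

No other point occurs (`norm_loopValues_lt_one`): if `‖z‖ ≥ 1`, the contraction `T = ‖z‖⁻¹ R_z` has
`ρ(T^k) = ‖z‖^k`, whereas `T^k → 0` weakly, because `T^*` strips edges off paths.

The loop values determine `ρ` (`eq_of_loopValues_eq`). With `a = ⟨A ξ_x, ξ_x⟩`, one has `P_x A = a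
P_x + ∑ L_f L_f^*(A - a)` over all edges `f` into `x`. The operators `L_f^*(A - a)` stay in `𝔏_G`
(`leftShift_mem`), the partial sums are bounded, and `ρ` kills every `L_f` that is not a loop. Hence
`ρ(A) = a + ρ(A')` with `A' = ∑ z_i L_{e_i}^*(A - a)`. Two characters with the same `z` thus have
the same difference at `A` and at `A'`, and iterating `A ↦ A'` tends to `0` in norm.

The inverse map is continuous because `z ↦ ν_z` is norm continuous. -/

theorem inner_basisVec (i : ι) (f : L2 ι) : inner ℂ (basisVec i) f = f i := by
  classical
  simp [basisVec, lp.inner_single_left]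

theorem inner_basisVec_self (i : ι) : inner ℂ (basisVec i) (basisVec i) = (1 : ℂ) := by
  simp [basisVec]

theorem inner_basisVec_of_ne {i j : ι} (h : i ≠ j) :
    inner ℂ (basisVec i) (basisVec j) = (0 : ℂ) := by
  rw [inner_basisVec]
  simp [basisVec, lp.single_apply, h]

theorem norm_basisVec (i : ι) : ‖basisVec i‖ = 1 := by
  simp [basisVec]

theorem ext_inner_basisVec {f g : L2 ι}
    (h : ∀ i, inner ℂ (basisVec i) f = inner ℂ (basisVec i) g) : f = g := by
  ext i
  simpa only [inner_basisVec] using h i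

theorem hasSum_basisVec (f : L2 ι) : HasSum (fun i => f i • basisVec i) f := by
  classical
  have h := lp.hasSum_single (E := fun _ : ι => ℂ) (p := 2) (by norm_num) f
  convert h using 2 with i
  simp only [basisVec]
  rw [← lp.single_smul]
  simp

theorem dense_span_basisVec :
    Dense (Submodule.span ℂ (Set.range (basisVec (ι := ι))) : Set (L2 ι)) := by
  intro f
  refine mem_closure_of_tendsto (hasSum_basisVec f) (Eventually.of_forall fun s => ?_)
  exact Submodule.sum_mem _ fun i _ =>
    Submodule.smul_mem _ _ (Submodule.subset_span ⟨i, rfl⟩)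

theorem clm_ext_basisVec {F : Type*} [NormedAddCommGroup F] [NormedSpace ℂ F]
    {A B : L2 ι →L[ℂ] F} (h : ∀ i, A (basisVec i) = B (basisVec i)) : A = B :=
  ContinuousLinearMap.ext_on dense_span_basisVec (by rintro _ ⟨i, rfl⟩; exact h i)

/-- A bounded net of operators which converges on the basis vectors converges strongly. -/
theorem tendsto_apply_of_basisVec {α F : Type*} [NormedAddCommGroup F] [NormedSpace ℂ F]
    {l : Filter α} {T : α → L2 ι →L[ℂ] F} {T₀ : L2 ι →L[ℂ] F} {C : ℝ} (hT : ∀ a, ‖T a‖ ≤ C)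
    (h : ∀ i, Tendsto (fun a => T a (basisVec i)) l (𝓝 (T₀ (basisVec i)))) (f : L2 ι) :
    Tendsto (fun a => T a f) l (𝓝 (T₀ f)) := by
  have hspan : ∀ g ∈ Submodule.span ℂ (Set.range (basisVec (ι := ι))),
      Tendsto (fun a => T a g) l (𝓝 (T₀ g)) := by
    intro g hg
    induction hg using Submodule.span_induction with
    | mem g hg => obtain ⟨i, rfl⟩ := hg; exact h i
    | zero => simpa using tendsto_const_nhds
    | add g g' _ _ hg hg' => simpa using hg.add hg'
    | smul c g _ hg => simpa using hg.const_smul c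
  rw [Metric.tendsto_nhds]
  intro ε hε
  have hK : 0 < |C| + ‖T₀‖ + 1 := by positivity
  obtain ⟨g, hg, hgf⟩ := Metric.dense_iff.1 dense_span_basisVec f (ε / 2 / (|C| + ‖T₀‖ + 1))
    (by positivity)
  rw [Metric.mem_ball, dist_comm, dist_eq_norm, lt_div_iff₀ hK] at hg
  filter_upwards [Metric.tendsto_nhds.1 (hspan g hgf) (ε / 2) (by positivity)] with a ha
  rw [dist_eq_norm] at ha ⊢
  have h1 : ‖T a (f - g)‖ ≤ |C| * ‖f - g‖ :=
    (T a).le_of_opNorm_le ((hT a).trans (le_abs_self C)) _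
  have h2 : ‖T₀ (f - g)‖ ≤ ‖T₀‖ * ‖f - g‖ := T₀.le_opNorm _
  have h3 : T a f - T₀ f = T a (f - g) - T₀ (f - g) + (T a g - T₀ g) := by
    simp only [map_sub]; abel
  rw [h3]
  have h4 := norm_add_le (T a (f - g) - T₀ (f - g)) (T a g - T₀ g)
  have h5 := norm_sub_le (T a (f - g)) (T₀ (f - g))
  nlinarith [norm_nonneg (f - g)]

end Basis

theorem inner_star_right {H : Type*} [NormedAddCommGroup H] [InnerProductSpace ℂ H]
    [CompleteSpace H] (A : H →L[ℂ] H) (f g : H) :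
    inner ℂ f (star A g) = inner ℂ (A f) g := by
  rw [ContinuousLinearMap.star_eq_adjoint, ContinuousLinearMap.adjoint_inner_right]

theorem inner_star_left {H : Type*} [NormedAddCommGroup H] [InnerProductSpace ℂ H]
    [CompleteSpace H] (A : H →L[ℂ] H) (f g : H) :
    inner ℂ (star A f) g = inner ℂ f (A g) := by
  rw [ContinuousLinearMap.star_eq_adjoint, ContinuousLinearMap.adjoint_inner_left]

theorem norm_star_clm {H : Type*} [NormedAddCommGroup H] [InnerProductSpace ℂ H]
    [CompleteSpace H] (A : H →L[ℂ] H) : ‖star A‖ = ‖A‖ := by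
  rw [ContinuousLinearMap.star_eq_adjoint]
  exact ContinuousLinearMap.adjoint.norm_map A

/-! ### Relations between the generators -/

section Relations

variable {V : Type u} [Quiver.{v} V]

/-- The edges of the graph, recorded as (source, range, edge). -/
abbrev Edge (V : Type u) [Quiver.{v} V] : Type (max u v) := Σ b c : V, (b ⟶ c)

/-- An edge together with its end points. -/
abbrev toEdge {b c : V} (e : b ⟶ c) : Edge V := ⟨b, c, e⟩

theorem fock_ext {F : Type*} [NormedAddCommGroup F] [NormedSpace ℂ F] {A B : Fock V →L[ℂ] F}
    (h : ∀ (a b : V) (p : Quiver.Path a b), A (xi ⟨a, p⟩) = B (xi ⟨a, p⟩)) : A = B :=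
  clm_ext_basisVec fun ⟨_, _, p⟩ => h _ _ p

theorem ext_inner_xi {f g : Fock V}
    (h : ∀ (a b : V) (p : Quiver.Path a b),
      inner ℂ (xi (⟨a, p⟩ : PathsInto b)) f = inner ℂ (xi (⟨a, p⟩ : PathsInto b)) g) : f = g :=
  ext_inner_basisVec fun ⟨_, _, p⟩ => h _ _ p

theorem star_creation_xi_nil {b c : V} (e : b ⟶ c) (d : V) :
    star (creation e) (xi (⟨d, Quiver.Path.nil⟩ : PathsInto d)) = 0 := by
  refine ext_inner_xi fun a b' p => ?_
  rw [inner_star_right, inner_zero_right]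
  by_cases h : b' = b
  · subst h
    rw [creation_xi]
    refine inner_basisVec_of_ne fun h => ?_
    cases h
  · rw [creation_xi_of_ne e h, inner_zero_left]

theorem star_creation_xi_cons {a b c : V} (e : b ⟶ c) (p : Quiver.Path a b) :
    star (creation e) (xi ⟨a, p.cons e⟩) = xi ⟨a, p⟩ := by
  refine ext_inner_xi fun a' b' q => ?_
  rw [inner_star_right]
  by_cases h : b' = b
  · subst h
    rw [creation_xi]
    by_cases hq : (⟨b', a', q⟩ : PathSpace V) = ⟨b', a, p⟩
    · cases hq
      simp only [xi, inner_basisVec_self]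
    · rw [xi, xi, xi, xi, inner_basisVec_of_ne hq, inner_basisVec_of_ne]
      intro h
      cases h
      exact hq rfl
  · rw [creation_xi_of_ne e h, inner_zero_left, inner_basisVec_of_ne]
    intro h'
    exact h (congrArg Sigma.fst h')

/-- The edges are compared in `Edge V` because their end points may differ, so `e ≠ f` would not
typecheck. -/
theorem star_creation_xi_cons_of_ne {a b c b' c' : V} (e : b ⟶ c) (f : b' ⟶ c')
    (h : toEdge e ≠ toEdge f) (p : Quiver.Path a b') :
    star (creation e) (xi ⟨a, p.cons f⟩) = 0 := by
  refine ext_inner_xi fun a' d q => ?_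
  rw [inner_star_right, inner_zero_right]
  by_cases hd : d = b
  · subst hd
    rw [creation_xi]
    refine inner_basisVec_of_ne fun h' => h ?_
    cases h'
    rfl
  · rw [creation_xi_of_ne e hd, inner_zero_left]

theorem star_creation_mul_self {b c : V} (e : b ⟶ c) :
    star (creation e) * creation e = vertexProj b := by
  refine fock_ext fun a d p => ?_
  rw [mul_apply_eq_comp]
  by_cases hd : d = b
  · subst hd
    rw [creation_xi, star_creation_xi_cons, vertexProj_xi]
  · rw [creation_xi_of_ne e hd, vertexProj_xi_of_ne hd, map_zero]

theorem star_creation_mul_of_ne {b c b' c' : V} (e : b ⟶ c) (f : b' ⟶ c')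
    (h : toEdge e ≠ toEdge f) : star (creation e) * creation f = 0 := by
  refine fock_ext fun a d p => ?_
  rw [mul_apply_eq_comp]
  by_cases hd : d = b'
  · subst hd
    rw [creation_xi, star_creation_xi_cons_of_ne e f h]
    rfl
  · rw [creation_xi_of_ne f hd, map_zero]
    rfl

theorem star_vertexProj (y : V) : star (vertexProj y) = vertexProj y := by
  rw [ContinuousLinearMap.star_eq_adjoint, vertexProj, restrict,
    ContinuousLinearMap.adjoint_comp, ContinuousLinearMap.adjoint_adjoint]

theorem vertexProj_mul_self (y : V) : vertexProj y * vertexProj y = vertexProj y := by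
  refine fock_ext fun a d p => ?_
  rw [mul_apply_eq_comp]
  by_cases hd : d = y
  · subst hd
    rw [vertexProj_xi, vertexProj_xi]
  · rw [vertexProj_xi_of_ne hd, map_zero]

theorem vertexProj_mul_of_ne {y z : V} (h : y ≠ z) : vertexProj y * vertexProj z = 0 := by
  refine fock_ext fun a d p => ?_
  rw [mul_apply_eq_comp, zero_apply]
  by_cases hd : d = z
  · subst hd
    rw [vertexProj_xi, vertexProj_xi_of_ne h.symm]
  · rw [vertexProj_xi_of_ne hd, map_zero]

theorem vertexProj_mul_creation {b c : V} (e : b ⟶ c) :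
    vertexProj c * creation e = creation e := by
  refine fock_ext fun a d p => ?_
  rw [mul_apply_eq_comp]
  by_cases hd : d = b
  · subst hd
    rw [creation_xi, vertexProj_xi]
  · rw [creation_xi_of_ne e hd, map_zero]

theorem creation_mul_vertexProj {b c : V} (e : b ⟶ c) :
    creation e * vertexProj b = creation e := by
  refine fock_ext fun a d p => ?_
  rw [mul_apply_eq_comp]
  by_cases hd : d = b
  · subst hd
    rw [vertexProj_xi]
  · rw [vertexProj_xi_of_ne hd, map_zero, creation_xi_of_ne e hd]

theorem star_creation_mul_vertexProj {b c : V} (e : b ⟶ c) :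
    star (creation e) * vertexProj c = star (creation e) := by
  rw [← star_vertexProj c, ← star_mul, vertexProj_mul_creation]

theorem star_creation_mul_vertexProj_of_ne {b c y : V} (e : b ⟶ c) (h : c ≠ y) :
    star (creation e) * vertexProj y = 0 := by
  rw [← star_creation_mul_vertexProj, mul_assoc, vertexProj_mul_of_ne h, mul_zero]

theorem isStarProjection_vertexProj (y : V) : IsStarProjection (vertexProj y) :=
  ⟨vertexProj_mul_self y, star_vertexProj y⟩

end Relations

variable {V : Type u} [Quiver.{v} V]

/-- The basis vector of the path of length `0` at `x`. -/
noncomputable abbrev vacuum (x : V) : Fock V := xi (⟨x, Quiver.Path.nil⟩ : PathsInto x)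

theorem star_creation_vacuum {b c : V} (e : b ⟶ c) (x : V) :
    star (creation e) (vacuum x) = 0 :=
  star_creation_xi_nil e x

/-! ### Range projections of creation operators -/

/-- The projection `L_e L_e^*`. -/
noncomputable def rangeProj {b c : V} (e : b ⟶ c) : Fock V →L[ℂ] Fock V :=
  creation e * star (creation e)

theorem rangeProj_mul_self {b c : V} (e : b ⟶ c) : rangeProj e * rangeProj e = rangeProj e := by
  rw [rangeProj, mul_assoc, ← mul_assoc (star _), star_creation_mul_self, ← mul_assoc,
    creation_mul_vertexProj]

theorem rangeProj_mul_of_ne {b c b' c' : V} (e : b ⟶ c) (f : b' ⟶ c')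
    (h : toEdge e ≠ toEdge f) : rangeProj e * rangeProj f = 0 := by
  rw [rangeProj, rangeProj, mul_assoc, ← mul_assoc (star _), star_creation_mul_of_ne e f h,
    zero_mul, mul_zero]

theorem toEdge_ne_of_ne {x : V} {f g : Σ b : V, (b ⟶ x)} (h : f ≠ g) :
    toEdge f.2 ≠ toEdge g.2 := by
  rintro h'
  obtain ⟨b, f⟩ := f
  obtain ⟨b', g⟩ := g
  cases h'
  exact h rfl

/-- The summands are mutually orthogonal projections. The resulting bound by `1`, uniform in `F`, is
what later allows passing to the limit over `F`. -/
theorem isStarProjection_sum_rangeProj {x : V} (F : Finset (Σ b : V, (b ⟶ x))) :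
    IsStarProjection (∑ f ∈ F, rangeProj f.2) := by
  constructor
  · rw [IsIdempotentElem, Finset.sum_mul_sum]
    refine Finset.sum_congr rfl fun f hf => ?_
    rw [Finset.sum_eq_single_of_mem f hf fun g _ hg =>
      rangeProj_mul_of_ne _ _ (toEdge_ne_of_ne hg.symm), rangeProj_mul_self]
  · rw [isSelfAdjoint_iff, star_sum]
    refine Finset.sum_congr rfl fun f _ => ?_
    rw [rangeProj, star_mul, star_star]

/-- The ranges of the creation operators of the edges with range `x` exhaust the range of `P_x`,
up to the basis vector of the vertex `x`. -/
theorem tendsto_sum_rangeProj (x : V) (g : Fock V) :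
    Tendsto (fun F : Finset (Σ b : V, (b ⟶ x)) => (∑ f ∈ F, rangeProj f.2) g) atTop
      (𝓝 (vertexProj x g - inner ℂ (vacuum x) g • vacuum x)) := by
  refine tendsto_apply_of_basisVec
    (T₀ := vertexProj x - (innerSL ℂ (vacuum x)).smulRight (vacuum x))
    (fun F => (isStarProjection_sum_rangeProj F).norm_le) ?_ g
  rintro ⟨c, a, p⟩
  simp only [sub_apply, ContinuousLinearMap.smulRight_apply, innerSL_apply_apply, sum_apply]
  change Tendsto (fun F : Finset (Σ b : V, (b ⟶ x)) => ∑ f ∈ F, rangeProj f.2 (xi ⟨a, p⟩)) atTop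
    (𝓝 (vertexProj x (xi ⟨a, p⟩) - inner ℂ (vacuum x) (xi ⟨a, p⟩) • vacuum x))
  have hne : ∀ {b' : V} (f : b' ⟶ x) {b : V} (e : b ⟶ c) (q : Quiver.Path a b),
      toEdge f ≠ toEdge e → rangeProj f (xi ⟨a, q.cons e⟩) = 0 := by
    intro b' f b e q h
    rw [rangeProj, mul_apply_eq_comp, star_creation_xi_cons_of_ne f e h, map_zero]
  cases p with
  | nil =>
    have h0 : ∀ F : Finset (Σ b : V, (b ⟶ x)),
        ∑ f ∈ F, rangeProj f.2 (vacuum c) = 0 := fun F =>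
      Finset.sum_eq_zero fun f _ => by
        rw [rangeProj, mul_apply_eq_comp, star_creation_vacuum, map_zero]
    simp only [h0]
    by_cases h : c = x
    · subst h
      rw [vertexProj_xi, inner_basisVec_self, one_smul, sub_self]
      exact tendsto_const_nhds
    · rw [vertexProj_xi_of_ne h, inner_basisVec_of_ne, zero_smul, sub_self]
      · exact tendsto_const_nhds
      · intro h'
        exact h (congrArg Sigma.fst h').symm
  | @cons b _ q e =>
    rw [inner_basisVec_of_ne (by intro h'; cases h'), zero_smul, sub_zero]
    by_cases h : c = x
    · subst h
      rw [vertexProj_xi]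
      refine tendsto_const_nhds.congr' ?_
      -- Once `F` contains the last edge `e`, that edge alone contributes and the partial sum is
      -- constant.
      filter_upwards [eventually_ge_atTop {(⟨b, e⟩ : Σ b : V, (b ⟶ c))}] with F hF
      rw [Finset.sum_eq_single_of_mem ⟨b, e⟩ (Finset.singleton_subset_iff.1 hF) fun f _ hf =>
        hne f.2 e q (toEdge_ne_of_ne hf), rangeProj, mul_apply_eq_comp, star_creation_xi_cons,
        creation_xi]
    · rw [vertexProj_xi_of_ne h]
      refine tendsto_const_nhds.congr fun F => (Finset.sum_eq_zero fun f _ => ?_).symm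
      exact hne f.2 e q fun h' => h (congrArg (fun t : Edge V => t.2.1) h').symm

/-! ### Weighted sums of loops -/

section Row

variable {x : V} {n : ℕ} (ε : Fin n → (x ⟶ x)) (z : EuclideanSpace ℂ (Fin n))

/-- The operator `∑ᵢ conj(zᵢ) L_{eᵢ}` for loops `eᵢ` at `x`. -/
noncomputable def row : Fock V →L[ℂ] Fock V := ∑ i, conj (z i) • creation (ε i)

theorem star_row : star (row ε z) = ∑ i, z i • star (creation (ε i)) := by
  simp [row, star_sum, star_smul]

theorem star_row_vacuum (y : V) : star (row ε z) (vacuum y) = 0 := by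
  rw [star_row, sum_apply]
  exact Finset.sum_eq_zero fun i _ => by rw [smul_apply, star_creation_vacuum, smul_zero]

theorem vertexProj_mul_row : vertexProj x * row ε z = row ε z := by
  simp only [row, Finset.mul_sum, mul_smul_comm, vertexProj_mul_creation]

theorem star_creation_mul_row_of_ne {b c : V} (e : b ⟶ c) (h : ∀ i, toEdge e ≠ toEdge (ε i)) :
    star (creation e) * row ε z = 0 := by
  simp only [row, Finset.mul_sum, mul_smul_comm]
  exact Finset.sum_eq_zero fun i _ => by rw [star_creation_mul_of_ne _ _ (h i), smul_zero]

theorem toEdge_injective (a b : V) : Function.Injective (toEdge : (a ⟶ b) → Edge V) := by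
  intro e f h
  cases h
  rfl

variable {ε}

theorem star_creation_mul_row (hε : Function.Injective ε) (i : Fin n) :
    star (creation (ε i)) * row ε z = conj (z i) • vertexProj x := by
  simp only [row, Finset.mul_sum, mul_smul_comm]
  rw [Finset.sum_eq_single_of_mem i (Finset.mem_univ i), star_creation_mul_self]
  intro j _ hj
  rw [star_creation_mul_of_ne, smul_zero]
  exact fun h => hj (hε (toEdge_injective _ _ h)).symm

/-- The cross terms vanish by orthogonality of the ranges, leaving `∑ z_i conj(z_i) P_x`. -/
theorem star_row_mul_row (hε : Function.Injective ε) :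
    star (row ε z) * row ε z = ((‖z‖ ^ 2 : ℝ) : ℂ) • vertexProj x := by
  rw [star_row, Finset.sum_mul]
  simp only [smul_mul_assoc, star_creation_mul_row z hε, smul_smul, ← Finset.sum_smul]
  congr 1
  rw [EuclideanSpace.norm_sq_eq]
  push_cast
  exact Finset.sum_congr rfl fun i _ => Complex.mul_conj' _

theorem norm_row_le (hε : Function.Injective ε) : ‖row ε z‖ ≤ ‖z‖ := by
  have h := CStarRing.norm_star_mul_self (x := row ε z)
  rw [star_row_mul_row z hε, norm_smul, Complex.norm_real, norm_pow, norm_norm] at h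
  have h1 := (isStarProjection_vertexProj x).norm_le
  refine le_of_sq_le_sq ?_ (norm_nonneg z)
  nlinarith [sq_nonneg ‖z‖]

end Row

/-! ### Joint eigenvectors of the adjoint algebra -/

/-- A property which holds on the algebra generated by the `L_e` and `P_x`, and which is closed in
the weak operator topology, holds on the free semigroupoid algebra. -/
theorem subset_of_isClosed {S : Set (Fock V →L[ℂ] Fock V)}
    (hS : IsClosed (ContinuousLinearMapWOT.toCLM ⁻¹' S : Set (Fock V →WOT[ℂ] Fock V)))
    (h : ∀ A ∈ NonUnitalAlgebra.adjoin ℂ (generators V), A ∈ S) {A : Fock V →L[ℂ] Fock V}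
    (hA : A ∈ freeSemigroupoidAlgebra V) : A ∈ S := by
  -- A set closed in the weak operator topology is also norm closed, so `S` survives both closures
  -- in turn.
  have hT : (tensorAlgebra V : Set (Fock V →L[ℂ] Fock V)) ⊆ S := by
    refine closure_minimal h ?_
    exact hS.preimage ContinuousLinearMapWOT.continuous_ofCLM
  rw [mem_freeSemigroupoidAlgebra_iff] at hA
  refine closure_minimal ?_ hS hA
  rintro _ ⟨B, hB, rfl⟩
  exact hT hB

theorem mem_of_mem_adjoin (A : Fock V →L[ℂ] Fock V)
    (hA : A ∈ NonUnitalAlgebra.adjoin ℂ (generators V)) :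
    A ∈ freeSemigroupoidAlgebra V := by
  rw [mem_freeSemigroupoidAlgebra_iff]
  exact subset_closure ⟨A, NonUnitalSubalgebra.le_topologicalClosure _ hA, rfl⟩

theorem creation_mem {b c : V} (e : b ⟶ c) : creation e ∈ freeSemigroupoidAlgebra V :=
  mem_of_mem_adjoin _ (NonUnitalAlgebra.subset_adjoin ℂ (Or.inl ⟨b, c, e, rfl⟩))

theorem continuous_inner_toCLM (f g : Fock V) :
    Continuous fun A : Fock V →WOT[ℂ] Fock V => (inner ℂ f (A.toCLM g) : ℂ) :=
  ContinuousLinearMapWOT.continuous_iff.1 continuous_id g f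

/-- If `ν` is a joint eigenvector of the adjoints of the generators, then it is one of the adjoints
of all elements of the free semigroupoid algebra. -/
theorem inner_apply_of_generators {x : V} {ν : Fock V} (h1 : inner ℂ ν (vacuum x) = (1 : ℂ))
    (h : ∀ A ∈ generators V, ∃ c : ℂ, star A ν = c • ν) {A : Fock V →L[ℂ] Fock V}
    (hA : A ∈ freeSemigroupoidAlgebra V) (g : Fock V) :
    (inner ℂ ν (A g) : ℂ) = inner ℂ ν (A (vacuum x)) * inner ℂ ν g := by
  revert g
  -- The quantifier over `g` belongs inside `S`: the product case uses the identity for `A` at the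
  -- vector `B g`.
  refine subset_of_isClosed (S := {A | ∀ g, (inner ℂ ν (A g) : ℂ) =
    inner ℂ ν (A (vacuum x)) * inner ℂ ν g}) ?_ ?_ hA
  · rw [Set.ofPred_forall, Set.preimage_iInter]
    exact isClosed_iInter fun g => isClosed_eq (continuous_inner_toCLM ν g)
      ((continuous_inner_toCLM ν (vacuum x)).mul continuous_const)
  · intro A hA
    induction hA using NonUnitalAlgebra.adjoin_induction with
    | mem A hA =>
      obtain ⟨c, hc⟩ := h A hA
      intro g
      simp only [← inner_star_left, hc, inner_smul_left, h1, mul_one]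
    | zero => intro g; simp
    | add A B _ _ hA hB =>
      intro g
      simp only [add_apply, inner_add_right, hA g, hB g, add_mul]
    | mul A B _ _ hA hB =>
      intro g
      simp only [mul_apply_eq_comp]
      rw [hA (B g), hA (B (vacuum x)), hB g, mul_assoc]
    | smul c A _ hA =>
      intro g
      simp only [smul_apply, inner_smul_right, hA g, mul_assoc]

theorem inner_vacuum_vacuum (x : V) : inner ℂ (vacuum x) (vacuum x) = (1 : ℂ) :=
  inner_basisVec_self _

/-- The vacuum vector is itself a joint eigenvector: each `L_e^*` kills it and each `P_y` fixes or
kills it. The coefficient at `x` is therefore multiplicative; it is the centre of the ball. -/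
theorem inner_vacuum_apply (x : V) {A : Fock V →L[ℂ] Fock V}
    (hA : A ∈ freeSemigroupoidAlgebra V) (g : Fock V) :
    (inner ℂ (vacuum x) (A g) : ℂ) = inner ℂ (vacuum x) (A (vacuum x)) * inner ℂ (vacuum x) g := by
  refine inner_apply_of_generators (inner_vacuum_vacuum x) ?_ hA g
  rintro _ (⟨b, c, e, rfl⟩ | ⟨y, rfl⟩)
  · exact ⟨0, by rw [star_creation_vacuum, zero_smul]⟩
  · rw [star_vertexProj]
    by_cases h : x = y
    · subst h
      exact ⟨1, by rw [vertexProj_xi, one_smul]⟩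
    · exact ⟨0, by rw [vertexProj_xi_of_ne h, zero_smul]⟩

section Eigenvector

variable {x : V} {n : ℕ} (ε : Fin n → (x ⟶ x)) (z : EuclideanSpace ℂ (Fin n))

/-- The vector `∑_w conj(z_w) ξ_w`, the sum over all words `w` in the loops `eᵢ`. -/
noncomputable def eigenvector : Fock V := Ring.inverse (1 - row ε z) (vacuum x)

variable {ε}

/-- This fixed point equation replaces the series over words: the adjoints of the generators act on
its two terms by the relations already known. -/
theorem eigenvector_eq (hε : Function.Injective ε) (hz : ‖z‖ < 1) :
    eigenvector ε z = vacuum x + row ε z (eigenvector ε z) := by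
  have h := Ring.mul_inverse_cancel _
    (isUnit_one_sub_of_norm_lt_one ((norm_row_le z hε).trans_lt hz))
  have h' := congrArg (fun T : Fock V →L[ℂ] Fock V => T (vacuum x)) h
  simp only [mul_apply_eq_comp, sub_apply, one_apply_eq_self] at h'
  exact sub_eq_iff_eq_add.1 h'

theorem inner_eigenvector_vacuum (hε : Function.Injective ε) (hz : ‖z‖ < 1) :
    inner ℂ (eigenvector ε z) (vacuum x) = (1 : ℂ) := by
  rw [eigenvector_eq z hε hz, inner_add_left, ← inner_star_right, star_row_vacuum,
    inner_zero_right, add_zero, inner_vacuum_vacuum]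

theorem vertexProj_eigenvector (hε : Function.Injective ε) (hz : ‖z‖ < 1) :
    vertexProj x (eigenvector ε z) = eigenvector ε z := by
  rw [eigenvector_eq z hε hz, map_add, vertexProj_xi, ← mul_apply_eq_comp, vertexProj_mul_row]

theorem star_creation_eigenvector (hε : Function.Injective ε) (hz : ‖z‖ < 1) (i : Fin n) :
    star (creation (ε i)) (eigenvector ε z) = conj (z i) • eigenvector ε z := by
  conv_lhs => rw [eigenvector_eq z hε hz]
  rw [map_add, star_creation_vacuum, zero_add, ← mul_apply_eq_comp, star_creation_mul_row z hε,
    smul_apply, vertexProj_eigenvector z hε hz]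

theorem inner_eigenvector_apply (hε : Function.Injective ε) (hz : ‖z‖ < 1)
    {A : Fock V →L[ℂ] Fock V} (hA : A ∈ freeSemigroupoidAlgebra V) (g : Fock V) :
    (inner ℂ (eigenvector ε z) (A g) : ℂ) =
      inner ℂ (eigenvector ε z) (A (vacuum x)) * inner ℂ (eigenvector ε z) g := by
  refine inner_apply_of_generators (inner_eigenvector_vacuum z hε hz) ?_ hA g
  rintro _ (⟨b, c, e, rfl⟩ | ⟨y, rfl⟩)
  · by_cases h : ∃ i, toEdge e = toEdge (ε i)
    · obtain ⟨i, hi⟩ := h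
      cases hi
      exact ⟨_, star_creation_eigenvector z hε hz i⟩
    · refine ⟨0, ?_⟩
      rw [eigenvector_eq z hε hz, map_add, star_creation_vacuum, ← mul_apply_eq_comp,
        star_creation_mul_row_of_ne ε z e (not_exists.1 h), zero_apply, add_zero, zero_smul]
  · rw [star_vertexProj]
    by_cases h : y = x
    · subst h
      exact ⟨1, by rw [vertexProj_eigenvector z hε hz, one_smul]⟩
    · refine ⟨0, ?_⟩
      rw [← vertexProj_eigenvector z hε hz, ← mul_apply_eq_comp, vertexProj_mul_of_ne h,
        zero_apply, zero_smul]

theorem continuousAt_eigenvector (hε : Function.Injective ε) (hz : ‖z‖ < 1) :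
    ContinuousAt (eigenvector ε) z := by
  have hrow : Continuous (row ε) := by
    unfold row
    fun_prop
  have hu := isUnit_one_sub_of_norm_lt_one ((norm_row_le z hε).trans_lt hz)
  have h1 : ContinuousAt (fun w => Ring.inverse (1 - row ε w)) z := by
    have h2 := NormedRing.inverse_continuousAt hu.unit
    rw [hu.unit_spec] at h2
    exact ContinuousAt.comp (f := fun w => 1 - row ε w) h2
      (continuous_const.sub hrow).continuousAt
  exact h1.clm_apply continuousAt_const

end Eigenvector

/-! ### Removing the leftmost edge -/

/-- The operator `L_e^* (A - a)`, where `a` is the coefficient of `A` at the vertex `r(e)`. -/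
noncomputable def leftShift {b c : V} (e : b ⟶ c) (A : Fock V →L[ℂ] Fock V) :
    Fock V →L[ℂ] Fock V :=
  star (creation e) * A - (inner ℂ (vacuum c) (A (vacuum c)) : ℂ) • star (creation e)

/-- A twisted Leibniz rule: as the coefficient at `c` is multiplicative, `AB - ab = (A - a)B + a(B -
b)` up to terms killed by `L_e^*`. -/
theorem leftShift_mul {b c : V} (e : b ⟶ c) {A B : Fock V →L[ℂ] Fock V}
    (hA : A ∈ freeSemigroupoidAlgebra V) :
    leftShift e (A * B) =
      leftShift e A * B + (inner ℂ (vacuum c) (A (vacuum c)) : ℂ) • leftShift e B := by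
  simp only [leftShift, mul_apply_eq_comp]
  rw [inner_vacuum_apply c hA (B (vacuum c)), sub_mul, smul_sub, smul_smul, smul_mul_assoc,
    mul_assoc]
  abel

theorem isClosed_freeSemigroupoidAlgebra :
    IsClosed {A : Fock V →WOT[ℂ] Fock V | A.toCLM ∈ freeSemigroupoidAlgebra V} := by
  simp only [mem_freeSemigroupoidAlgebra_iff]
  exact isClosed_closure

/-- Subtracting `a` is essential: `P_c` would otherwise go to `L_e^*`, and now goes to `0`. Products
are handled by the twisted Leibniz rule. -/
theorem leftShift_mem {b c : V} (e : b ⟶ c) {A : Fock V →L[ℂ] Fock V}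
    (hA : A ∈ freeSemigroupoidAlgebra V) : leftShift e A ∈ freeSemigroupoidAlgebra V := by
  refine subset_of_isClosed (S := {A | leftShift e A ∈ freeSemigroupoidAlgebra V}) ?_ ?_ hA
  · have hc : Continuous fun A : Fock V →WOT[ℂ] Fock V =>
        ContinuousLinearMapWOT.ofCLM (leftShift e A.toCLM) := by
      rw [ContinuousLinearMapWOT.continuous_iff]
      intro f g
      have h : ∀ A : Fock V →WOT[ℂ] Fock V,
          inner ℂ g (ContinuousLinearMapWOT.ofCLM (leftShift e A.toCLM) f) =
            (inner ℂ (creation e g) (A.toCLM f) : ℂ) -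
              inner ℂ (vacuum c) (A.toCLM (vacuum c)) * inner ℂ (creation e g) f := by
        intro A
        simp only [leftShift, ContinuousLinearMapWOT.ofCLM_apply, sub_apply, smul_apply,
          mul_apply_eq_comp, inner_sub_right, inner_smul_right, inner_star_right]
      simp only [h]
      exact (continuous_inner_toCLM _ _).sub
        ((continuous_inner_toCLM _ _).mul continuous_const)
    exact isClosed_freeSemigroupoidAlgebra.preimage hc
  · intro A hA
    induction hA using NonUnitalAlgebra.adjoin_induction with
    | mem A hA =>
      obtain ⟨b', c', f, rfl⟩ | ⟨y, rfl⟩ := hA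
      · have h0 : (inner ℂ (vacuum c) (creation f (vacuum c)) : ℂ) = 0 := by
          rw [← inner_star_left, star_creation_vacuum, inner_zero_left]
        by_cases h : toEdge e = toEdge f
        · cases h
          simp only [Set.mem_ofPred_eq, leftShift, h0, zero_smul, sub_zero, star_creation_mul_self]
          exact vertexProj_mem b
        · simp only [Set.mem_ofPred_eq, leftShift, h0, zero_smul, sub_zero,
            star_creation_mul_of_ne e f h]
          exact zero_mem _
      · have h0 : leftShift e (vertexProj y) = 0 := by
          by_cases h : c = y
          · subst h
            rw [leftShift, vertexProj_xi, inner_vacuum_vacuum, one_smul,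
              star_creation_mul_vertexProj, sub_self]
          · rw [leftShift, vertexProj_xi_of_ne h, inner_zero_right, zero_smul,
              star_creation_mul_vertexProj_of_ne e h, sub_self]
        rw [Set.mem_ofPred_eq, h0]
        exact zero_mem _
    | zero => simp [leftShift]
    | add A B _ _ hA hB =>
      have h : leftShift e (A + B) = leftShift e A + leftShift e B := by
        simp only [leftShift, mul_add, add_apply, inner_add_right, add_smul]
        abel
      rw [Set.mem_ofPred_eq, h]
      exact add_mem hA hB
    | mul A B hA' hB' hA hB =>
      rw [Set.mem_ofPred_eq, leftShift_mul e (mem_of_mem_adjoin A hA')]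
      exact add_mem (mul_mem hA (mem_of_mem_adjoin B hB')) (SMulMemClass.smul_mem _ hB)
    | smul t A _ hA =>
      have h : leftShift e (t • A) = t • leftShift e A := by
        simp only [leftShift, mul_smul_comm, smul_apply, inner_smul_right, smul_sub, smul_smul]
      rw [Set.mem_ofPred_eq, h]
      exact SMulMemClass.smul_mem _ hA

/-! ### Weak-star continuity -/

/-- A `w*`-continuous function respects limits of bounded nets in the weak operator topology. -/
theorem IsWeakStarContinuous.tendsto {φ : freeSemigroupoidAlgebra V → ℂ}
    (hφ : IsWeakStarContinuous φ) {α : Type*} {l : Filter α} {A : α → freeSemigroupoidAlgebra V}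
    {A₀ : freeSemigroupoidAlgebra V} {C : ℝ}
    (hC : ∀ a, ‖(A a : Fock V →L[ℂ] Fock V)‖ ≤ C)
    (h : ∀ f g : Fock V, Tendsto (fun a => (inner ℂ f ((A a : Fock V →L[ℂ] Fock V) g) : ℂ)) l
      (𝓝 (inner ℂ f ((A₀ : Fock V →L[ℂ] Fock V) g)))) :
    Tendsto (fun a => φ (A a)) l (𝓝 (φ A₀)) := by
  have hφ' : Tendsto φ (@nhds _ ((weakStarTopology (Fock V)).induced Subtype.val) A₀)
      (𝓝 (φ A₀)) :=
    @Continuous.tendsto _ _ ((weakStarTopology (Fock V)).induced Subtype.val) _ _ hφ A₀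
  refine hφ'.comp ?_
  -- The topology is an infimum of induced ones, so convergence is tested on one functional at a
  -- time, by dominated convergence of its series.
  rw [@nhds_induced _ _ (weakStarTopology (Fock V)) Subtype.val A₀, tendsto_comap_iff]
  simp only [nhds_iInf, tendsto_iInf, nhds_induced, tendsto_comap_iff]
  intro x y
  have hx : Summable fun k => ‖x k‖ ^ 2 := by simpa using (lp.memℓp x).summable (by norm_num)
  have hy : Summable fun k => ‖y k‖ ^ 2 := by simpa using (lp.memℓp y).summable (by norm_num)
  refine tendsto_tsum_of_dominated_convergence ((hy.add hx).mul_left |C|)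
    (fun k => h (y k) (x k)) (Eventually.of_forall fun a k => ?_)
  have h1 : ‖(inner ℂ (y k) ((A a : Fock V →L[ℂ] Fock V) (x k)) : ℂ)‖ ≤
      ‖y k‖ * (|C| * ‖x k‖) :=
    (norm_inner_le_norm _ _).trans (by
      gcongr
      exact ContinuousLinearMap.le_of_opNorm_le _ ((hC a).trans (le_abs_self C)) _)
  refine h1.trans ?_
  have h2 : ‖y k‖ * ‖x k‖ ≤ ‖y k‖ ^ 2 + ‖x k‖ ^ 2 := by
    nlinarith [sq_nonneg (‖y k‖ - ‖x k‖), sq_nonneg ‖x k‖, sq_nonneg ‖y k‖]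
  calc ‖y k‖ * (|C| * ‖x k‖) = |C| * (‖y k‖ * ‖x k‖) := by ring
    _ ≤ _ := mul_le_mul_of_nonneg_left h2 (abs_nonneg C)

theorem isWeakStarContinuous_inner (f g : Fock V) :
    IsWeakStarContinuous fun A : freeSemigroupoidAlgebra V =>
      (inner ℂ f ((A : Fock V →L[ℂ] Fock V) g) : ℂ) := by
  have h : @Continuous _ _ (weakStarTopology (Fock V)) inferInstance
      fun A : Fock V →L[ℂ] Fock V => (inner ℂ f (A g) : ℂ) := by
    rw [continuous_iff_le_induced]
    -- Sequences supported at index `0` realize a single matrix coefficient.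
    refine (iInf_le _ (lp.single 2 0 g)).trans ((iInf_le _ (lp.single 2 0 f)).trans (le_of_eq ?_))
    congr 1
    funext A
    rw [tsum_eq_single 0]
    · simp
    · intro k hk
      simp [lp.single_apply, Pi.single_eq_of_ne hk]
  exact @Continuous.comp _ _ _ ((weakStarTopology (Fock V)).induced Subtype.val)
    (weakStarTopology (Fock V)) _ _ _ h
    (@continuous_induced_dom _ _ Subtype.val (weakStarTopology (Fock V)))

/-! ### The loop values of a character -/

section Character

open WeakDual

variable {x : V} {ρ : characterSpace ℂ (freeSemigroupoidAlgebra V)}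

/-- From `P_y P_x = 0` and `ρ(P_x) = 1` follows `ρ(P_y) = 0` for `y ≠ x`, and `L_e = P_c L_e P_b`.
-/
theorem character_creation_eq_zero (hρ : ρ ∈ weakStarCharacters x) {b c : V} (e : b ⟶ c)
    (h : ¬ (b = x ∧ c = x)) : ρ ⟨creation e, creation_mem e⟩ = 0 := by
  have hP : ∀ y, y ≠ x → ρ ⟨vertexProj y, vertexProj_mem y⟩ = 0 := by
    intro y hy
    have h1 : (⟨vertexProj y, vertexProj_mem y⟩ : freeSemigroupoidAlgebra V) *
        ⟨vertexProj x, vertexProj_mem x⟩ = 0 := Subtype.ext (vertexProj_mul_of_ne hy)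
    have h2 := congrArg ρ h1
    rwa [map_mul, hρ.2, mul_one, map_zero] at h2
  by_cases hb : b = x
  · have hc : c ≠ x := fun hc => h ⟨hb, hc⟩
    have h1 : (⟨vertexProj c, vertexProj_mem c⟩ : freeSemigroupoidAlgebra V) *
        ⟨creation e, creation_mem e⟩ = ⟨creation e, creation_mem e⟩ :=
      Subtype.ext (vertexProj_mul_creation e)
    rw [← h1, map_mul, hP c hc, zero_mul]
  · have h1 : (⟨creation e, creation_mem e⟩ : freeSemigroupoidAlgebra V) *
        ⟨vertexProj b, vertexProj_mem b⟩ = ⟨creation e, creation_mem e⟩ :=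
      Subtype.ext (creation_mul_vertexProj e)
    rw [← h1, map_mul, hP b hb, mul_zero]

variable {n : ℕ} (ε : Fin n → (x ⟶ x))

/-- The values of a character at the operators `L_e` for the loops `e` at `x`. -/
noncomputable def loopValues (ρ : characterSpace ℂ (freeSemigroupoidAlgebra V)) :
    EuclideanSpace ℂ (Fin n) :=
  WithLp.toLp 2 fun i => ρ ⟨creation (ε i), creation_mem (ε i)⟩

/-- The operator `∑ᵢ zᵢ L_{eᵢ}^* (A - a)`, where `a` is the coefficient of `A` at `x`. -/
noncomputable def loopShift (z : EuclideanSpace ℂ (Fin n)) (A : freeSemigroupoidAlgebra V) :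
    freeSemigroupoidAlgebra V :=
  ∑ i, z i • ⟨leftShift (ε i) A, leftShift_mem (ε i) A.2⟩

/-- Collecting the terms into `R_z^*` gives estimates by the Euclidean norm of `z`. -/
theorem coe_loopShift (z : EuclideanSpace ℂ (Fin n)) (A : freeSemigroupoidAlgebra V) :
    (loopShift ε z A : Fock V →L[ℂ] Fock V) = star (row ε z) * (A : Fock V →L[ℂ] Fock V) -
      (inner ℂ (vacuum x) ((A : Fock V →L[ℂ] Fock V) (vacuum x)) : ℂ) • star (row ε z) := by
  rw [loopShift, AddSubmonoidClass.coe_finsetSum, star_row, Finset.sum_mul, Finset.smul_sum,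
    ← Finset.sum_sub_distrib]
  refine Finset.sum_congr rfl fun i _ => ?_
  change z i • leftShift (ε i) (A : Fock V →L[ℂ] Fock V) = _
  rw [leftShift, smul_sub, smul_mul_assoc, smul_comm]

variable {ε}

/-- A `w*`-continuous character is compatible with the decomposition of an operator according to
the leftmost edge of the words in its Fourier expansion. -/
theorem character_eq_add_loopShift (hε : Function.Bijective ε) (hρ : ρ ∈ weakStarCharacters x)
    (A : freeSemigroupoidAlgebra V) :
    ρ A = inner ℂ (vacuum x) ((A : Fock V →L[ℂ] Fock V) (vacuum x)) +
      ρ (loopShift ε (loopValues ε ρ) A) := by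
  set a : ℂ := inner ℂ (vacuum x) ((A : Fock V →L[ℂ] Fock V) (vacuum x)) with ha
  let P : freeSemigroupoidAlgebra V := ⟨vertexProj x, vertexProj_mem x⟩
  let L : (Σ b : V, (b ⟶ x)) → freeSemigroupoidAlgebra V :=
    fun f => ⟨creation f.2, creation_mem f.2⟩
  let D : (Σ b : V, (b ⟶ x)) → freeSemigroupoidAlgebra V :=
    fun f => ⟨leftShift f.2 A, leftShift_mem f.2 A.2⟩
  have hcoe : ∀ F : Finset (Σ b : V, (b ⟶ x)),
      ((∑ f ∈ F, L f * D f : freeSemigroupoidAlgebra V) : Fock V →L[ℂ] Fock V) =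
        (∑ f ∈ F, rangeProj f.2) * ((A : Fock V →L[ℂ] Fock V) - a • 1) := by
    intro F
    rw [AddSubmonoidClass.coe_finsetSum, Finset.sum_mul]
    refine Finset.sum_congr rfl fun f _ => ?_
    rw [NonUnitalSubalgebra.coe_mul]
    simp only [L, D, leftShift, rangeProj, mul_sub, mul_smul_comm, mul_one, mul_assoc]
    rw [ha]
  -- The limit carries a factor `P`, since the identity need not lie in the algebra.
  have hlim : Tendsto (fun F : Finset (Σ b : V, (b ⟶ x)) => ρ (∑ f ∈ F, L f * D f)) atTop
      (𝓝 (ρ (P * A - a • P))) := by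
    refine IsWeakStarContinuous.tendsto (φ := fun A => ρ A) hρ.1
      (C := ‖(A : Fock V →L[ℂ] Fock V) - a • 1‖) (fun F => ?_) (fun f g => ?_)
    · rw [hcoe]
      refine (norm_mul_le _ _).trans ?_
      exact mul_le_of_le_one_left (norm_nonneg _) (isStarProjection_sum_rangeProj F).norm_le
    · simp only [hcoe, mul_apply_eq_comp]
      have h := (tendsto_const_nhds (x := f)).inner (𝕜 := ℂ)
        (tendsto_sum_rangeProj x (((A : Fock V →L[ℂ] Fock V) - a • 1) g))
      -- The range of `A - a` is orthogonal to `ξ_x`, so the correction term in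
      -- `tendsto_sum_rangeProj` disappears.
      have h0 : (inner ℂ (vacuum x) (((A : Fock V →L[ℂ] Fock V) - a • 1) g) : ℂ) = 0 := by
        rw [sub_apply, inner_sub_right, inner_vacuum_apply x A.2, smul_apply, inner_smul_right,
          one_apply_eq_self, ← ha, sub_self]
      rw [h0, zero_smul, sub_zero] at h
      have h1 : ((P * A - a • P : freeSemigroupoidAlgebra V) : Fock V →L[ℂ] Fock V) g =
          vertexProj x (((A : Fock V →L[ℂ] Fock V) - a • 1) g) := by
        rw [sub_apply, smul_apply, one_apply_eq_self, map_sub, map_smul]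
        rfl
      rw [h1]
      exact h
  -- Finiteness of the set of loops enters here: the net is constant once `F` contains them all.
  have hev : ∀ᶠ F : Finset (Σ b : V, (b ⟶ x)) in atTop, ρ (∑ f ∈ F, L f * D f) =
      ρ (loopShift ε (loopValues ε ρ) A) := by
    let j : Fin n ↪ (Σ b : V, (b ⟶ x)) := ⟨fun i => ⟨x, ε i⟩, fun i k h =>
      hε.1 (sigma_mk_injective (β := fun b : V => b ⟶ x) h)⟩
    filter_upwards [eventually_ge_atTop (Finset.univ.map j)] with F hF
    rw [map_sum, ← Finset.sum_subset hF, Finset.sum_map, loopShift, map_sum]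
    · refine Finset.sum_congr rfl fun i _ => ?_
      rw [map_mul, map_smul, smul_eq_mul]
      rfl
    · rintro ⟨b, f⟩ _ hf
      rw [map_mul, character_creation_eq_zero hρ f, zero_mul]
      rintro ⟨rfl, -⟩
      obtain ⟨i, rfl⟩ := hε.2 f
      exact hf (Finset.mem_map.2 ⟨i, Finset.mem_univ i, rfl⟩)
  have hfin := tendsto_nhds_unique hlim (tendsto_const_nhds.congr' (hev.mono fun _ h => h.symm))
  rw [map_sub, map_mul, map_smul, hρ.2, one_mul, smul_eq_mul, mul_one] at hfin
  rw [← hfin]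
  ring

/-! ### Decay of the iterated loop shifts and uniqueness of the character -/

theorem norm_iterate_loopShift_vacuum (hε : Function.Injective ε) (z : EuclideanSpace ℂ (Fin n))
    (A : freeSemigroupoidAlgebra V) (k : ℕ) :
    ‖(((loopShift ε z)^[k] A : freeSemigroupoidAlgebra V) : Fock V →L[ℂ] Fock V) (vacuum x)‖ ≤
      ‖z‖ ^ k * ‖(A : Fock V →L[ℂ] Fock V)‖ := by
  induction k with
  | zero =>
    have h := (A : Fock V →L[ℂ] Fock V).le_opNorm (vacuum x)
    rw [norm_basisVec, mul_one] at h
    simpa using h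
  | succ k ih =>
    rw [Function.iterate_succ_apply', coe_loopShift, sub_apply, smul_apply, star_row_vacuum,
      smul_zero, sub_zero, mul_apply_eq_comp, pow_succ', mul_assoc]
    refine ((star (row ε z)).le_opNorm _).trans ?_
    rw [norm_star_clm]
    exact mul_le_mul (norm_row_le z hε) ih (norm_nonneg _) (norm_nonneg _)

/-- The crude bound `2‖z‖` per step would not decay for `‖z‖ ≥ 1/2`. But on `ξ_x` the subtracted
term vanishes, so the coefficients at `x` already decay like `‖z‖^k`, and each step only adds one
more term of that size. -/
theorem norm_iterate_loopShift_le (hε : Function.Injective ε) (z : EuclideanSpace ℂ (Fin n))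
    (A : freeSemigroupoidAlgebra V) (k : ℕ) :
    ‖(((loopShift ε z)^[k] A : freeSemigroupoidAlgebra V) : Fock V →L[ℂ] Fock V)‖ ≤
      (k + 1) * ‖z‖ ^ k * ‖(A : Fock V →L[ℂ] Fock V)‖ := by
  induction k with
  | zero => simp
  | succ k ih =>
    rw [Function.iterate_succ_apply', coe_loopShift]
    set B : Fock V →L[ℂ] Fock V :=
      (((loopShift ε z)^[k] A : freeSemigroupoidAlgebra V) : Fock V →L[ℂ] Fock V)
    have hR : ‖star (row ε z)‖ ≤ ‖z‖ := by rw [norm_star_clm]; exact norm_row_le z hε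
    have h1 : ‖(inner ℂ (vacuum x) (B (vacuum x)) : ℂ)‖ ≤
        ‖z‖ ^ k * ‖(A : Fock V →L[ℂ] Fock V)‖ := by
      refine (norm_inner_le_norm _ _).trans ?_
      rw [norm_basisVec, one_mul]
      exact norm_iterate_loopShift_vacuum hε z A k
    calc ‖star (row ε z) * B - (inner ℂ (vacuum x) (B (vacuum x)) : ℂ) • star (row ε z)‖
        ≤ ‖star (row ε z)‖ * ‖B‖ +
          ‖(inner ℂ (vacuum x) (B (vacuum x)) : ℂ)‖ * ‖star (row ε z)‖ := by
          refine (norm_sub_le _ _).trans (add_le_add (norm_mul_le _ _) (norm_smul _ _).le)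
      _ ≤ ‖z‖ * ((k + 1) * ‖z‖ ^ k * ‖(A : Fock V →L[ℂ] Fock V)‖) +
          ‖z‖ ^ k * ‖(A : Fock V →L[ℂ] Fock V)‖ * ‖z‖ := by gcongr
      _ = _ := by push_cast; ring

theorem eq_of_loopValues_eq (hε : Function.Bijective ε) (hρ : ρ ∈ weakStarCharacters x)
    {σ : characterSpace ℂ (freeSemigroupoidAlgebra V)} (hσ : σ ∈ weakStarCharacters x)
    (h : loopValues ε ρ = loopValues ε σ) (hz : ‖loopValues ε ρ‖ < 1) : ρ = σ := by
  refine CharacterSpace.ext fun A => ?_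
  set z := loopValues ε ρ with hzdef
  have hiter : ∀ k, ρ A - σ A = ρ ((loopShift ε z)^[k] A) - σ ((loopShift ε z)^[k] A) := by
    intro k
    induction k with
    | zero => rfl
    | succ k ih =>
      rw [ih, Function.iterate_succ_apply', character_eq_add_loopShift hε hρ,
        character_eq_add_loopShift hε hσ ((loopShift ε z)^[k] A), ← h, ← hzdef]
      ring
  have hlim : Tendsto (fun k => (loopShift ε z)^[k] A) atTop (𝓝 0) := by
    rw [tendsto_subtype_rng]
    refine squeeze_zero_norm (norm_iterate_loopShift_le hε.1 z A) ?_
    have h1 := tendsto_self_mul_const_pow_of_lt_one (norm_nonneg z) hz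
    have h2 := tendsto_pow_atTop_nhds_zero_of_lt_one (norm_nonneg z) hz
    simpa [add_mul] using (h1.add h2).mul_const ‖(A : Fock V →L[ℂ] Fock V)‖
  have hρ0 : Tendsto (fun k => ρ ((loopShift ε z)^[k] A)) atTop (𝓝 (ρ 0)) :=
    ((map_continuous ρ).tendsto 0).comp hlim
  have hσ0 : Tendsto (fun k => σ ((loopShift ε z)^[k] A)) atTop (𝓝 (σ 0)) :=
    ((map_continuous σ).tendsto 0).comp hlim
  have h0 := hρ0.sub hσ0
  simp only [← hiter, map_zero, sub_zero] at h0
  exact sub_eq_zero.1 (tendsto_nhds_unique tendsto_const_nhds h0)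

/-! ### The loop values lie in the open unit ball -/

/-- Each application of `R_z^*` removes the leftmost edge or gives `0`, so one more application than
the length of `p` suffices. -/
theorem exists_star_row_pow_eq_zero (z : EuclideanSpace ℂ (Fin n)) {a b : V}
    (p : Quiver.Path a b) : ∃ m : ℕ, ∀ k ≥ m, (star (row ε z) ^ k) (xi ⟨a, p⟩) = 0 := by
  induction p with
  | nil =>
    refine ⟨1, fun k hk => ?_⟩
    obtain ⟨k, rfl⟩ := Nat.exists_eq_add_of_le' hk
    rw [pow_succ, mul_apply_eq_comp, star_row_vacuum, map_zero]
  | @cons b c p e ih =>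
    obtain ⟨m, hm⟩ := ih
    refine ⟨m + 1, fun k hk => ?_⟩
    obtain ⟨k, rfl⟩ := Nat.exists_eq_add_of_le' (Nat.le_of_add_left_le hk)
    have hk' : m ≤ k := by omega
    rw [pow_succ, mul_apply_eq_comp, star_row, sum_apply, map_sum]
    refine Finset.sum_eq_zero fun i _ => ?_
    rw [smul_apply, map_smul]
    by_cases h : toEdge (ε i) = toEdge e
    · cases h
      rw [star_creation_xi_cons, ← star_row, hm k hk', smul_zero]
    · rw [star_creation_xi_cons_of_ne _ _ h, map_zero, smul_zero]

theorem row_mem (z : EuclideanSpace ℂ (Fin n)) : row ε z ∈ freeSemigroupoidAlgebra V :=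
  sum_mem fun _ _ => SMulMemClass.smul_mem _ (creation_mem _)

theorem character_row (z : EuclideanSpace ℂ (Fin n)) :
    ρ ⟨row ε z, row_mem z⟩ = ∑ i, conj (z i) * loopValues ε ρ i := by
  have h : (⟨row ε z, row_mem z⟩ : freeSemigroupoidAlgebra V) =
      ∑ i, conj (z i) • ⟨creation (ε i), creation_mem (ε i)⟩ := by
    refine Subtype.ext ?_
    rw [AddSubmonoidClass.coe_finsetSum]
    rfl
  rw [h, map_sum]
  exact Finset.sum_congr rfl fun i _ => by rw [map_smul]; rfl

theorem norm_loopValues_lt_one (hε : Function.Injective ε) (hρ : ρ ∈ weakStarCharacters x) :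
    ‖loopValues ε ρ‖ < 1 := by
  by_contra! hz
  set z := loopValues ε ρ with hzdef
  have hz0 : ‖z‖ ≠ 0 := by positivity
  set T : Fock V →L[ℂ] Fock V := ((‖z‖⁻¹ : ℝ) : ℂ) • row ε z with hT
  have hTmem : T ∈ freeSemigroupoidAlgebra V := SMulMemClass.smul_mem _ (row_mem z)
  have hTnorm : ‖T‖ ≤ 1 := by
    rw [hT, norm_smul, Complex.norm_real, norm_inv, norm_norm]
    calc ‖z‖⁻¹ * ‖row ε z‖ ≤ ‖z‖⁻¹ * ‖z‖ := by gcongr; exact norm_row_le z hε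
      _ = 1 := inv_mul_cancel₀ hz0
  have hρT : ρ ⟨T, hTmem⟩ = ‖z‖ := by
    have h : (⟨T, hTmem⟩ : freeSemigroupoidAlgebra V) =
        ((‖z‖⁻¹ : ℝ) : ℂ) • ⟨row ε z, row_mem z⟩ := rfl
    rw [h, map_smul, character_row, ← hzdef, smul_eq_mul]
    have h2 : ∑ i, conj (z i) * z i = ((‖z‖ ^ 2 : ℝ) : ℂ) := by
      rw [EuclideanSpace.norm_sq_eq]
      push_cast
      exact Finset.sum_congr rfl fun i _ => Complex.conj_mul' _
    rw [h2, ← Complex.ofReal_mul]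
    congr 1
    field_simp
  -- Exponents start at `1` because `T ^ 0` need not lie in the algebra.
  have hmem : ∀ k : ℕ, T ^ (k + 1) ∈ freeSemigroupoidAlgebra V := by
    intro k
    induction k with
    | zero => simpa using hTmem
    | succ k ih => rw [pow_succ]; exact mul_mem ih hTmem
  have hval : ∀ k : ℕ, ρ ⟨T ^ (k + 1), hmem k⟩ = (‖z‖ : ℂ) ^ (k + 1) := by
    intro k
    induction k with
    | zero =>
      have h : (⟨T ^ (0 + 1), hmem 0⟩ : freeSemigroupoidAlgebra V) = ⟨T, hTmem⟩ :=
        Subtype.ext (pow_one T)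
      rw [h, hρT, zero_add, pow_one]
    | succ k ih =>
      have h : (⟨T ^ (k + 1 + 1), hmem (k + 1)⟩ : freeSemigroupoidAlgebra V) =
          ⟨T ^ (k + 1), hmem k⟩ * ⟨T, hTmem⟩ := Subtype.ext (pow_succ T (k + 1))
      rw [h, map_mul, ih, hρT, ← pow_succ]
  have hnorm : ∀ (S : Fock V →L[ℂ] Fock V) (k : ℕ), ‖S‖ ≤ 1 → ‖S ^ (k + 1)‖ ≤ 1 := fun S k hS =>
    (norm_pow_le' S k.succ_pos).trans (pow_le_one₀ (norm_nonneg _) hS)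
  -- Strong convergence of the adjoint powers to `0` gives weak convergence of the powers of `T`.
  have hstar : ∀ f, Tendsto (fun k : ℕ => (star T ^ (k + 1)) f) atTop (𝓝 0) := by
    refine tendsto_apply_of_basisVec (T₀ := 0) (C := 1)
      (fun k => hnorm _ k (by rwa [norm_star_clm])) ?_
    rintro ⟨b, a, p⟩
    obtain ⟨m, hm⟩ := exists_star_row_pow_eq_zero (ε := ε) z p
    refine tendsto_const_nhds.congr' ?_
    filter_upwards [eventually_ge_atTop m] with k hk
    rw [hT, star_smul, smul_pow, smul_apply]
    change _ = _ • (star (row ε z) ^ (k + 1)) (xi ⟨a, p⟩)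
    rw [hm (k + 1) (by omega), smul_zero]
    rfl
  have hlim : Tendsto (fun k : ℕ => ρ ⟨T ^ (k + 1), hmem k⟩) atTop (𝓝 (ρ 0)) := by
    refine IsWeakStarContinuous.tendsto (φ := fun A => ρ A) hρ.1 (C := 1)
      (fun k => hnorm T k hTnorm) (fun f g => ?_)
    have h := (hstar f).inner (𝕜 := ℂ) (g := fun _ => g) tendsto_const_nhds
    simp only [← star_pow, inner_star_left] at h
    simpa using h
  simp only [hval, map_zero] at hlim
  have h1 := (hlim.norm).eventually_lt_const (u := 1) (by simp)
  obtain ⟨k, hk⟩ := h1.exists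
  rw [norm_pow, Complex.norm_real, norm_norm] at hk
  exact absurd (one_le_pow₀ hz) (not_le.2 hk)

end Character

/-! ### The characters given by points of the open unit ball -/

section Evaluation

open WeakDual

variable {x : V} {n : ℕ} {ε : Fin n → (x ⟶ x)}

/-- The functional `A ↦ ⟨A ξ_x, ν⟩` on the free semigroupoid algebra. -/
noncomputable def vectorFunctional (x : V) (ν : Fock V) :
    WeakDual ℂ (freeSemigroupoidAlgebra V) :=
  StrongDual.toWeakDual
    { toFun := fun A => inner ℂ ν ((A : Fock V →L[ℂ] Fock V) (vacuum x))
      map_add' := fun _ _ => inner_add_right _ _ _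
      map_smul' := fun _ _ => inner_smul_right _ _ _
      cont := continuous_const.inner (continuous_subtype_val.clm_apply continuous_const) }

theorem vectorFunctional_apply (ν : Fock V) (A : freeSemigroupoidAlgebra V) :
    vectorFunctional x ν A = inner ℂ ν ((A : Fock V →L[ℂ] Fock V) (vacuum x)) := rfl

theorem vectorFunctional_eigenvector_vertexProj (hε : Function.Injective ε)
    {z : EuclideanSpace ℂ (Fin n)} (hz : ‖z‖ < 1) :
    vectorFunctional x (eigenvector ε z) ⟨vertexProj x, vertexProj_mem x⟩ = 1 := by
  rw [vectorFunctional_apply, vertexProj_xi, inner_eigenvector_vacuum z hε hz]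

/-- The character with loop values `z`. -/
noncomputable def ballCharacter (hε : Function.Injective ε) {z : EuclideanSpace ℂ (Fin n)}
    (hz : ‖z‖ < 1) : characterSpace ℂ (freeSemigroupoidAlgebra V) :=
  ⟨vectorFunctional x (eigenvector ε z), by
    constructor
    · intro h
      have h1 := vectorFunctional_eigenvector_vertexProj hε hz
      rw [h] at h1
      exact zero_ne_one h1
    · intro A B
      exact inner_eigenvector_apply z hε hz A.2 _⟩

theorem ballCharacter_mem (hε : Function.Injective ε) {z : EuclideanSpace ℂ (Fin n)}
    (hz : ‖z‖ < 1) : ballCharacter hε hz ∈ weakStarCharacters x :=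
  ⟨isWeakStarContinuous_inner _ _, vectorFunctional_eigenvector_vertexProj hε hz⟩

theorem loopValues_ballCharacter (hε : Function.Injective ε) {z : EuclideanSpace ℂ (Fin n)}
    (hz : ‖z‖ < 1) : loopValues ε (ballCharacter hε hz) = z := by
  ext i
  change (inner ℂ (eigenvector ε z) (creation (ε i) (vacuum x)) : ℂ) = z i
  -- The conjugate in the eigenvalue cancels the one from the conjugate-linear first slot of the
  -- inner product.
  rw [← inner_star_left, star_creation_eigenvector z hε hz, inner_smul_left,
    inner_eigenvector_vacuum z hε hz, Complex.conj_conj, mul_one]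

/-- The `w*`-continuous characters over `x` are parametrized by the open unit ball. -/
noncomputable def weakStarCharactersHomeomorph (hε : Function.Bijective ε) :
    weakStarCharacters x ≃ₜ Metric.ball (0 : EuclideanSpace ℂ (Fin n)) 1 where
  toFun ρ := ⟨loopValues ε ρ.1, mem_ball_zero_iff.2 (norm_loopValues_lt_one hε.1 ρ.2)⟩
  invFun z := 
    ⟨ballCharacter hε.1 (mem_ball_zero_iff.1 z.2), ballCharacter_mem hε.1 _⟩
  left_inv ρ := Subtype.ext <| by
    have hz := norm_loopValues_lt_one hε.1 ρ.2
    refine eq_of_loopValues_eq hε (ballCharacter_mem hε.1 hz) ρ.2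
      (loopValues_ballCharacter hε.1 hz) ?_
    rwa [loopValues_ballCharacter hε.1 hz]
  right_inv z := Subtype.ext (loopValues_ballCharacter hε.1 (mem_ball_zero_iff.1 z.2))
  continuous_toFun := by
    refine Continuous.subtype_mk ?_ _
    refine (PiLp.continuous_toLp 2 _).comp (continuous_pi fun i => ?_)
    exact (WeakDual.eval_continuous _).comp (continuous_subtype_val.comp continuous_subtype_val)
  continuous_invFun := by
    refine Continuous.subtype_mk (Continuous.subtype_mk ?_ _) _
    refine WeakDual.continuous_of_continuous_eval fun A => ?_
    rw [continuous_iff_continuousAt]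
    intro z
    have h := (continuousAt_eigenvector z.1 hε.1 (mem_ball_zero_iff.1 z.2)).comp
      (x := z) continuous_subtype_val.continuousAt
    exact h.inner continuousAt_const

end Evaluation

end FreeSemigroupoid

theorem mainTheorem11 {V : Type*} [Quiver V] [Countable V]
    [∀ a b : V, Countable (a ⟶ b)] (x : V) (n : ℕ) (hn : ENat.card (x ⟶ x) = n) :
    Nonempty (FreeSemigroupoid.weakStarCharacters x ≃ₜ
      Metric.ball (0 : EuclideanSpace ℂ (Fin n)) 1) := by
  have hfin : Finite (x ⟶ x) := ENat.card_lt_top.1 (by rw [hn]; exact ENat.natCast_lt_top n)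
  have hcard : Nat.card (x ⟶ x) = n := by rw [Nat.card, ← ENat.toNat_natCast n, ← hn]; rfl
  exact ⟨FreeSemigroupoid.weakStarCharactersHomeomorph
    (Finite.equivFinOfCardEq hcard).symm.bijective⟩
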